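/- Let $M$ be a compact complex manifold of dimension $k$ with a (smooth) Hermitian metric $ds_M^2=\sum h_{ij}\,dz_i\,d\bar z_j$, and put $E_M(p,v)=(ds_M^2(v,\bar v))^{1/2}$ for $p\in M$, $v\in T_pM$. Let $\varphi:[0,\infty)\to(0,\infty)$ be a function such that, with $$\gamma_r:=\sup_{r\le a<b}\left|\frac{\varphi(a)-\varphi(b)}{a-b}\right|,$$ there is a constant $C\in(0,1]$ with $\gamma_r\le C$ for all $r\in(0,\infty)$, and $\lim_{r\to\infty}\gamma_r=0$. For complex manifolds $X,Y$ let $\mathcal H(X,Y)$ be the space of holomorphic mappings $X\to Y$ with the compact-open topology; a family $\mathcal F\subset\mathcal H(X,Y)$ is called normal on $X$ if every sequence in $\mathcal F$ has a subsequence which is relatively compact in $\mathcal H(X,Y)$. Let $f\in\mathcal H(\mathbb C^m,M)$. Then $f$ is a weighted Yosida mapping, that is, $$\limsup_{\|z\|\to\infty,\ \|\xi\|=1}\varphi(\|z\|)\,E_M\big(f(z),df(z)(\xi)\big)<\infty,$$ if and only if for all sequences $\{z_j\},\{\xi_j\}\subset\mathbb C^m$ with $\|z_j\|\to\infty$ and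 $\|\xi_j\|=1$ for all $j$, the family $$\mathcal F=\{F_j:\ j\in\mathbb N\},\qquad F_j(\zeta):=f\big(z_j+\varphi(\|z_j\|)\,\xi_j\,\zeta\big)\quad(\zeta\in\mathbb C),$$ is normal on $\mathbb C$. -/

import Mathlib

open Filter Topology
open scoped Manifold ContDiff ENNReal

/-- `ℂⁿ` with its Euclidean norm; also the model space of `n`-dimensional complex manifolds. -/
abbrev Cn (n : ℕ) : Type := EuclideanSpace ℂ (Fin n)

/-- The space `H(X, Y)` of holomorphic mappings between complex manifolds modelled on normed spaces
`E` and `F`, with the topology induced by the compact-open topology of `C(X, Y)`. -/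
abbrev HolMap (E : Type*) [NormedAddCommGroup E] [NormedSpace ℂ E]
    (F : Type*) [NormedAddCommGroup F] [NormedSpace ℂ F]
    (X : Type*) [TopologicalSpace X] [ChartedSpace E X]
    (Y : Type*) [TopologicalSpace Y] [ChartedSpace F Y] : Type _ :=
  {f : C(X, Y) // MDifferentiable 𝓘(ℂ, E) 𝓘(ℂ, F) f}

/-- A family of holomorphic mappings is normal if every sequence in it has a subsequence which is
relatively compact in the space of holomorphic mappings. -/
def IsNormalFamily {E : Type*} [NormedAddCommGroup E] [NormedSpace ℂ E]
    {F : Type*} [NormedAddCommGroup F] [NormedSpace ℂ F]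
    {X : Type*} [TopologicalSpace X] [ChartedSpace E X]
    {Y : Type*} [TopologicalSpace Y] [ChartedSpace F Y] (𝓕 : Set (HolMap E F X Y)) : Prop :=
  ∀ u : ℕ → HolMap E F X Y, (∀ n, u n ∈ 𝓕) →
    ∃ s : ℕ → ℕ, StrictMono s ∧ IsCompact (closure (Set.range (u ∘ s)))

/-- The coordinate vector field `∂/∂zᵢ` of the chart `e`, at the point with coordinates `y`. -/
noncomputable def coordVector {k : ℕ} {M : Type*} [TopologicalSpace M] [ChartedSpace (Cn k) M]
    (e : OpenPartialHomeomorph M (Cn k)) (i : Fin k) (y : Cn k) :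
    TangentSpace 𝓘(ℂ, Cn k) (e.symm y) :=
  mfderiv 𝓘(ℂ, Cn k) 𝓘(ℂ, Cn k) e.symm y (EuclideanSpace.single i (1 : ℂ))

/-- A (smooth) Hermitian metric `ds² = ∑ hᵢⱼ dzᵢ dz̄ⱼ` on a `k`-dimensional complex manifold. -/
structure HermitianMetric (k : ℕ) (M : Type*) [TopologicalSpace M] [ChartedSpace (Cn k) M] where
  /-- The form on each tangent space, linear in the first and conjugate-linear in the second
  variable. -/
  form (p : M) : TangentSpace 𝓘(ℂ, Cn k) p →ₗ[ℂ] TangentSpace 𝓘(ℂ, Cn k) p →ₗ⋆[ℂ] ℂ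
  conj_symm (p : M) (v w : TangentSpace 𝓘(ℂ, Cn k) p) :
    (starRingEnd ℂ) (form p w v) = form p v w
  pos (p : M) (v : TangentSpace 𝓘(ℂ, Cn k) p) (hv : v ≠ 0) : 0 < (form p v v).re
  /-- In every chart of the atlas the coefficients `hᵢⱼ` are smooth (in the real sense). -/
  smooth (e : OpenPartialHomeomorph M (Cn k)) (he : e ∈ atlas (Cn k) M) (i j : Fin k) :
    ContDiffOn ℝ ∞ (fun y : Cn k ↦ form (e.symm y) (coordVector e i y) (coordVector e j y)) e.target

/-- The length `E_M(p, v) = (ds²(v, v̄))^{1/2}` of a tangent vector. -/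
noncomputable def HermitianMetric.length {k : ℕ} {M : Type*} [TopologicalSpace M]
    [ChartedSpace (Cn k) M] (h : HermitianMetric k M) (p : M)
    (v : TangentSpace 𝓘(ℂ, Cn k) p) : ℝ :=
  √(h.form p v v).re

/-- `γ_r = sup_{r ≤ a < b} |(φ(a) - φ(b)) / (a - b)|`, as an element of `[0, ∞]`. -/
noncomputable def slopeSup (φ : ℝ → ℝ) (r : ℝ) : ℝ≥0∞ :=
  ⨆ (a : ℝ) (b : ℝ) (_ : r ≤ a) (_ : a < b), ENNReal.ofReal |(φ a - φ b) / (a - b)|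

/-- Admissible weights `φ : [0, ∞) → (0, ∞)`; the values at negative numbers play no role. -/
structure IsYosidaWeight (φ : ℝ → ℝ) : Prop where
  pos : ∀ r : ℝ, 0 ≤ r → 0 < φ r
  bound : ∃ C : ℝ, 0 < C ∧ C ≤ 1 ∧ ∀ r : ℝ, 0 < r → slopeSup φ r ≤ ENNReal.ofReal C
  tendsto_zero : Tendsto (slopeSup φ) atTop (𝓝 0)

/-- `f` is a weighted Yosida mapping:
`limsup_{‖z‖ → ∞, ‖ξ‖ = 1} φ(‖z‖) E_M(f(z), df(z)(ξ)) < ∞`. -/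
def IsWeightedYosida {m k : ℕ} {M : Type*} [TopologicalSpace M] [ChartedSpace (Cn k) M]
    (h : HermitianMetric k M) (φ : ℝ → ℝ) (f : HolMap (Cn m) (Cn k) (Cn m) M) : Prop :=
  limsup (fun q : Cn m × Cn m ↦ ENNReal.ofReal
      (φ ‖q.1‖ * h.length (f.1 q.1) (mfderiv 𝓘(ℂ, Cn m) 𝓘(ℂ, Cn k) f.1 q.1 q.2)))
    (comap (fun z : Cn m ↦ ‖z‖) atTop ×ˢ 𝓟 {ξ : Cn m | ‖ξ‖ = 1}) < ⊤

/-- The holomorphic mapping `ζ ↦ f(z + t ξ ζ)` from `ℂ` to `M`. -/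
noncomputable def rescale {m k : ℕ} {M : Type*} [TopologicalSpace M] [ChartedSpace (Cn k) M]
    (f : HolMap (Cn m) (Cn k) (Cn m) M) (z : Cn m) (t : ℝ) (ξ : Cn m) :
    HolMap ℂ (Cn k) ℂ M :=
  ⟨⟨fun ζ : ℂ ↦ f.1 (z + ((t : ℂ) * ζ) • ξ), by fun_prop⟩, by
    have hd : Differentiable ℂ (fun ζ : ℂ ↦ z + ((t : ℂ) * ζ) • ξ) := by fun_prop
    exact f.2.comp hd.mdifferentiable⟩

/-! By the chain rule the speed of $F_j$ at $\zeta$ is $\varphi(\|z_j\|)\,E_M(f(w),df(w)(\xi_j))$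
with $w=z_j+\varphi(\|z_j\|)\xi_j\zeta$ (`speed_rescale`). At $\zeta=0$ this is exactly the quantity
in the Yosida condition.

If $f$ is Yosida, then $\gamma_r\to0$ makes $\varphi(\|z_j\|)\le2\varphi(\|w\|)$ for bounded $\zeta$
and large $j$ (`exists_le_two_mul`), so the speeds are locally bounded. Bounded speed gives
equicontinuity (`equicontinuousAt_of_speed_le`), and Arzelà–Ascoli with Weierstrass gives normality
(`isCompact_closure_of_equicontinuous`).

If $f$ is not Yosida, some sequence has $F_n$ of speed greater than $n$ at $0$. By Cauchy's estimate
the speed at $0$ is bounded on compact sets of holomorphic curves (`exists_speed_le_of_isCompact`),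
so this family is not normal. -/

/-! ### Weights -/

/-- On the discs of radius `r φ(x)` around far away points `x` the weight `φ` is comparable to
`φ(x)`. -/
theorem IsYosidaWeight.exists_le_two_mul {φ : ℝ → ℝ} (hφ : IsYosidaWeight φ) {r : ℝ} (hr : 0 < r)
    (R : ℝ) :
    ∃ T : ℝ, ∀ x y : ℝ, T ≤ x → |y - x| ≤ r * φ x → R ≤ y ∧ 0 < φ y ∧ φ x ≤ 2 * φ y := by
  -- With slope at most `ε`, the weight changes by at most `ε * (r * φ x) = φ x / 2` on the
  -- interval.
  set ε : ℝ := 1 / (2 * r) with hε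
  have hε0 : 0 < ε := by positivity
  have hεr : ε * r = 1 / 2 := by rw [hε]; field_simp
  have hev : ∀ᶠ a in atTop, slopeSup φ a < ENNReal.ofReal ε :=
    hφ.tendsto_zero.eventually_lt_const (by simpa using hε0)
  obtain ⟨a, hsa, haR⟩ := (hev.and (eventually_ge_atTop (max R 0))).exists
  have haR' : R ≤ a := (le_max_left _ _).trans haR
  have ha0 : 0 ≤ a := (le_max_right _ _).trans haR
  have key : ∀ u v, a ≤ u → u < v → |φ u - φ v| ≤ ε * (v - u) := by
    intro u v hu huv
    have h1 : ENNReal.ofReal |(φ u - φ v) / (u - v)| ≤ slopeSup φ a :=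
      le_iSup_of_le u (le_iSup_of_le v (le_iSup_of_le hu (le_iSup_of_le huv le_rfl)))
    have h2 := (ENNReal.ofReal_le_ofReal_iff hε0.le).1 (h1.trans hsa.le)
    rw [abs_div, abs_sub_comm u v, abs_of_pos (sub_pos.2 huv), div_le_iff₀ (sub_pos.2 huv)] at h2
    exact h2
  have key' : ∀ u v, a ≤ u → a ≤ v → |φ u - φ v| ≤ ε * |v - u| := by
    intro u v hu hv
    rcases lt_trichotomy u v with huv | rfl | huv
    · rw [abs_of_pos (sub_pos.2 huv)]; exact key u v hu huv
    · simp
    · rw [abs_sub_comm, abs_sub_comm v, abs_of_pos (sub_pos.2 huv)]; exact key v u hv huv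
  have hφa := hφ.pos a ha0
  have hrφ : 0 < r * φ a := by positivity
  -- Since `r * φ x ≤ r * φ a + (x - a) / 2`, this threshold keeps `x - r * φ x ≥ a`, where the
  -- slope bound is valid.
  refine ⟨a + 2 * (r * φ a), fun x y hx hxy => ?_⟩
  have hax : a ≤ x := by linarith
  have h1 := key' a x le_rfl hax
  rw [abs_of_nonneg (sub_nonneg.2 hax)] at h1
  have h2 : φ x ≤ φ a + ε * (x - a) := by linarith [neg_abs_le (φ a - φ x)]
  have h3 : r * φ x ≤ r * φ a + (x - a) / 2 := by
    calc r * φ x ≤ r * (φ a + ε * (x - a)) := by gcongr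
      _ = r * φ a + (ε * r) * (x - a) := by ring
      _ = _ := by rw [hεr]; ring
  have hay : a ≤ y := by linarith [neg_abs_le (y - x)]
  have h4 := key' x y hax hay
  have h5 : |φ x - φ y| ≤ φ x / 2 := by
    calc _ ≤ ε * |y - x| := h4
      _ ≤ ε * (r * φ x) := by gcongr
      _ = (ε * r) * φ x := by ring
      _ = _ := by rw [hεr]; ring
  exact ⟨haR'.trans hay, hφ.pos y (ha0.trans hay), by linarith [le_abs_self (φ x - φ y)]⟩

/-! ### Lengths of tangent vectors in a chart -/

namespace HermitianMetric

variable {k : ℕ} {M : Type*} [TopologicalSpace M] [ChartedSpace (Cn k) M]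

theorem length_smul (h : HermitianMetric k M) (p : M) (t : ℂ) (v : TangentSpace 𝓘(ℂ, Cn k) p) :
    h.length p (t • v) = ‖t‖ * h.length p v := by
  have : (h.form p (t • v) (t • v)).re = ‖t‖ ^ 2 * (h.form p v v).re := by
    simp only [map_smul, LinearMap.smul_apply, map_smulₛₗ, smul_eq_mul]
    rw [← mul_assoc, mul_comm _ t, Complex.mul_conj, Complex.re_ofReal_mul, Complex.normSq_eq_norm_sq]
  rw [length, this, Real.sqrt_mul (by positivity), Real.sqrt_sq (norm_nonneg _), length]

/-- Typing `v` and `w` in the model space avoids transport between tangent spaces at equal points.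
-/
theorem length_congr (h : HermitianMetric k M) {p q : M} (hpq : p = q) {v w : Cn k} (hvw : v = w) :
    h.length p v = h.length q w := by
  subst hpq hvw; rfl

/-- The length of the tangent vector with coordinates `w` at the point with coordinates `y`. -/
noncomputable def chartLength (h : HermitianMetric k M) (e : OpenPartialHomeomorph M (Cn k))
    (y w : Cn k) : ℝ :=
  h.length (e.symm y) (mfderiv 𝓘(ℂ, Cn k) 𝓘(ℂ, Cn k) e.symm y w)

theorem chartLength_smul (h : HermitianMetric k M) (e : OpenPartialHomeomorph M (Cn k))
    (y : Cn k) (t : ℂ) (w : Cn k) : h.chartLength e y (t • w) = ‖t‖ * h.chartLength e y w := by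
  rw [chartLength, chartLength, ← length_smul]
  exact h.length_congr rfl ((mfderiv 𝓘(ℂ, Cn k) 𝓘(ℂ, Cn k) e.symm y).map_smul t w)

theorem chartLength_eq_sum (h : HermitianMetric k M) (e : OpenPartialHomeomorph M (Cn k))
    (y w : Cn k) :
    h.chartLength e y w = √(∑ i, ∑ j, w i * (starRingEnd ℂ (w j) *
      h.form (e.symm y) (coordVector e i y) (coordVector e j y))).re := by
  have hw : mfderiv 𝓘(ℂ, Cn k) 𝓘(ℂ, Cn k) e.symm y w = ∑ i, w i • coordVector e i y := by
    have : w = ∑ i, w i • EuclideanSpace.single i (1 : ℂ) := by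
      ext i
      simp [Finset.sum_apply, Pi.single_apply]
    conv_lhs => rw [this]
    exact (map_sum (mfderiv 𝓘(ℂ, Cn k) 𝓘(ℂ, Cn k) e.symm y) _ _).trans
      (Finset.sum_congr rfl fun i _ =>
        (mfderiv 𝓘(ℂ, Cn k) 𝓘(ℂ, Cn k) e.symm y).map_smul _ _)
  rw [chartLength, length, hw]
  simp only [map_sum, map_smul, map_smulₛₗ, LinearMap.sum_apply, LinearMap.smul_apply, smul_eq_mul,
    Finset.mul_sum]
  congr 2
  rw [Finset.sum_comm]
  refine Finset.sum_congr rfl fun i _ => Finset.sum_congr rfl fun j _ => ?_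
  ring

theorem continuousOn_chartLength (h : HermitianMetric k M) {e : OpenPartialHomeomorph M (Cn k)}
    (he : e ∈ atlas (Cn k) M) :
    ContinuousOn (fun q : Cn k × Cn k => h.chartLength e q.1 q.2) (e.target ×ˢ Set.univ) := by
  simp only [chartLength_eq_sum]
  refine Real.continuous_sqrt.comp_continuousOn (Complex.continuous_re.comp_continuousOn ?_)
  refine continuousOn_finsetSum _ fun i _ => continuousOn_finsetSum _ fun j _ => ?_
  have hs := (h.smooth e he i j).continuousOn.comp
    (continuousOn_fst (s := e.target ×ˢ (Set.univ : Set (Cn k)))) (fun q hq => hq.1)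
  have h1 : Continuous fun q : Cn k × Cn k => q.2 i := by fun_prop
  have h2 : Continuous fun q : Cn k × Cn k => starRingEnd ℂ (q.2 j) :=
    Complex.continuous_conj.comp (by fun_prop)
  exact h1.continuousOn.mul (h2.continuousOn.mul hs)

/-- The derivative of `e.symm` is injective, being inverted by that of `e`. -/
theorem chartLength_pos [IsManifold 𝓘(ℂ, Cn k) ω M] (h : HermitianMetric k M)
    {e : OpenPartialHomeomorph M (Cn k)} (he : e ∈ atlas (Cn k) M) {y w : Cn k}
    (hy : y ∈ e.target) (hw : w ≠ 0) : 0 < h.chartLength e y w := by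
  have : IsManifold 𝓘(ℂ, Cn k) 1 M := IsManifold.of_le (n := ω) le_top
  refine Real.sqrt_pos.2 (h.pos _ _ fun h0 => hw ?_)
  have hd : e.MDifferentiable 𝓘(ℂ, Cn k) 𝓘(ℂ, Cn k) := mdifferentiable_of_mem_atlas he
  have h1 := congrArg (fun L => L w) (hd.comp_symm_deriv hy)
  have h2 : mfderiv 𝓘(ℂ, Cn k) 𝓘(ℂ, Cn k) e (e.symm y)
      (mfderiv 𝓘(ℂ, Cn k) 𝓘(ℂ, Cn k) e.symm y w) = w := h1
  rw [h0] at h2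
  exact h2.symm.trans (map_zero (mfderiv 𝓘(ℂ, Cn k) 𝓘(ℂ, Cn k) e (e.symm y)))

/-- On a compact subset of a chart the metric is comparable to the Euclidean one. -/
theorem exists_chartLength_bounds [IsManifold 𝓘(ℂ, Cn k) ω M] (h : HermitianMetric k M)
    {e : OpenPartialHomeomorph M (Cn k)} (he : e ∈ atlas (Cn k) M) {K : Set (Cn k)}
    (hK : IsCompact K) (hKe : K ⊆ e.target) :
    ∃ c C : ℝ, 0 < c ∧ 0 < C ∧
      ∀ y ∈ K, ∀ w, c * ‖w‖ ≤ h.chartLength e y w ∧ h.chartLength e y w ≤ C * ‖w‖ := by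
  -- By homogeneity it suffices to bound the length on unit vectors, where compactness applies.
  have hcomp : IsCompact (K ×ˢ Metric.sphere (0 : Cn k) 1) := hK.prod (isCompact_sphere _ _)
  have hcont := (h.continuousOn_chartLength he).mono
    (Set.prod_mono hKe (Set.subset_univ (Metric.sphere (0 : Cn k) 1)))
  obtain ⟨c, hc, hc'⟩ := hcomp.exists_forall_le' hcont (a := 0) (fun q hq =>
    h.chartLength_pos he (hKe hq.1) (ne_zero_of_mem_unit_sphere ⟨q.2, hq.2⟩))
  obtain ⟨C, hC⟩ := hcomp.exists_bound_of_continuousOn hcont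
  refine ⟨c, max C 1, hc, by positivity, fun y hy w => ?_⟩
  rcases eq_or_ne w 0 with rfl | hw
  · have := h.chartLength_smul e y 0 0
    simp only [zero_smul, norm_zero, zero_mul] at this
    simp [this]
  have hn : 0 < ‖w‖ := norm_pos_iff.2 hw
  set u : Cn k := ((‖w‖⁻¹ : ℝ) : ℂ) • w with hu
  have hu1 : u ∈ Metric.sphere (0 : Cn k) 1 := by
    simp [hu, norm_smul, hn.ne']
  have hwu : w = ((‖w‖ : ℝ) : ℂ) • u := by
    rw [hu, smul_smul, ← Complex.ofReal_mul, mul_inv_cancel₀ hn.ne', Complex.ofReal_one, one_smul]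
  have h1 : h.chartLength e y w = ‖w‖ * h.chartLength e y u := by
    conv_lhs => rw [hwu, h.chartLength_smul]
    simp
  have h2 := hc' (y, u) ⟨hy, hu1⟩
  have h3 := hC (y, u) ⟨hy, hu1⟩
  simp only at h2 h3
  rw [h1, mul_comm c, mul_comm (max C 1)]
  exact ⟨by gcongr, by gcongr; exact (le_abs_self _).trans (h3.trans (le_max_left _ _))⟩

/-- The length of the velocity of a curve `F : ℂ → M`. -/
noncomputable def speed (h : HermitianMetric k M) (F : ℂ → M) (ζ : ℂ) : ℝ :=
  h.length (F ζ) (mfderiv 𝓘(ℂ, ℂ) 𝓘(ℂ, Cn k) F ζ (1 : ℂ))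

theorem differentiableAt_chart_comp [IsManifold 𝓘(ℂ, Cn k) ω M]
    {e : OpenPartialHomeomorph M (Cn k)} (he : e ∈ atlas (Cn k) M) {F : ℂ → M}
    (hF : MDifferentiable 𝓘(ℂ, ℂ) 𝓘(ℂ, Cn k) F) {ζ : ℂ} (hζ : F ζ ∈ e.source) :
    DifferentiableAt ℂ (e ∘ F) ζ := by
  have : IsManifold 𝓘(ℂ, Cn k) 1 M := IsManifold.of_le (n := ω) le_top
  exact ((mdifferentiableAt_atlas he hζ).comp ζ (hF ζ)).differentiableAt

/-- Near `ζ` the curve is `e.symm ∘ (e ∘ F)`. The chain rule thus reduces speed to an ordinary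
derivative, open to mean value and Cauchy estimates. -/
theorem speed_eq_chartLength [IsManifold 𝓘(ℂ, Cn k) ω M] (h : HermitianMetric k M)
    {e : OpenPartialHomeomorph M (Cn k)} (he : e ∈ atlas (Cn k) M) {F : ℂ → M}
    (hF : MDifferentiable 𝓘(ℂ, ℂ) 𝓘(ℂ, Cn k) F) {ζ : ℂ} (hζ : F ζ ∈ e.source) :
    h.speed F ζ = h.chartLength e (e (F ζ)) (deriv (e ∘ F) ζ) := by
  have : IsManifold 𝓘(ℂ, Cn k) 1 M := IsManifold.of_le (n := ω) le_top
  have hev : F =ᶠ[𝓝 ζ] e.symm ∘ (e ∘ F) := by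
    filter_upwards [(hF ζ).continuousAt.preimage_mem_nhds (e.open_source.mem_nhds hζ)] with w hw
    exact (e.left_inv hw).symm
  have hd := differentiableAt_chart_comp he hF hζ
  refine h.length_congr (e.left_inv hζ).symm ?_
  have h1 : mfderiv 𝓘(ℂ, ℂ) 𝓘(ℂ, Cn k) F ζ =
    mfderiv 𝓘(ℂ, ℂ) 𝓘(ℂ, Cn k) (e.symm ∘ (e ∘ F)) ζ := hev.mfderiv_eq
  have h2 : mfderiv 𝓘(ℂ, ℂ) 𝓘(ℂ, Cn k) (e.symm ∘ (e ∘ F)) ζ =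
      (mfderiv 𝓘(ℂ, Cn k) 𝓘(ℂ, Cn k) e.symm (e (F ζ))).comp
        (mfderiv 𝓘(ℂ, ℂ) 𝓘(ℂ, Cn k) (e ∘ F) ζ) :=
    mfderiv_comp ζ (mdifferentiableAt_atlas_symm he (e.map_source hζ)) hd.mdifferentiableAt
  rw [h1, h2, mfderiv_eq_fderiv]
  change mfderiv 𝓘(ℂ, Cn k) 𝓘(ℂ, Cn k) e.symm (e (F ζ)) (fderiv ℂ (e ∘ F) ζ 1) = _
  rw [fderiv_apply_one_eq_deriv]

end HermitianMetric

/-! ### Bounded speed and equicontinuity; local boundedness of the speed. -/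

namespace HermitianMetric

variable {k : ℕ} {M : Type*} [TopologicalSpace M] [ChartedSpace (Cn k) M]
  [IsManifold 𝓘(ℂ, Cn k) ω M]

/-- A family of holomorphic curves with bounded speed cannot leave a chart quickly. -/
theorem exists_nhds_eventually_mem_of_speed_le [T2Space M] (h : HermitianMetric k M)
    {ι : Type*} {F : ι → ℂ → M} (hF : ∀ i, MDifferentiable 𝓘(ℂ, ℂ) 𝓘(ℂ, Cn k) (F i))
    {ζ₀ : ℂ} {δ₀ K : ℝ} (hδ₀ : 0 < δ₀) (hK : ∀ i, ∀ ζ ∈ Metric.ball ζ₀ δ₀, h.speed (F i) ζ ≤ K)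
    {p : M} {W : Set M} (hW : W ∈ 𝓝 p) :
    ∃ V ∈ 𝓝 p, ∀ᶠ ζ in 𝓝 ζ₀, ∀ i, F i ζ₀ ∈ V → F i ζ ∈ W := by
  set e := chartAt (Cn k) p
  have he : e ∈ atlas (Cn k) M := chart_mem_atlas _ _
  have hp : p ∈ e.source := mem_chart_source _ _
  have hn : e.target ∩ e.symm ⁻¹' W ∈ 𝓝 (e p) := by
    refine inter_mem (e.open_target.mem_nhds (e.map_source hp)) ?_
    exact (e.continuousAt_symm (e.map_source hp)).preimage_mem_nhds (by rwa [e.left_inv hp])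
  obtain ⟨ρ, hρ, hball⟩ := Metric.nhds_basis_closedBall.mem_iff.1 hn
  have hsub : Metric.closedBall (e p) ρ ⊆ e.target := fun y hy => (hball hy).1
  obtain ⟨c, _, hc, -, hcb⟩ := h.exists_chartLength_bounds he (isCompact_closedBall (e p) ρ) hsub
  -- Bound for the coordinate derivative as long as the curve stays in the `ρ`-ball.
  set L : ℝ := |K| / c
  have hL : 0 ≤ L := by positivity
  refine ⟨e.source ∩ e ⁻¹' Metric.ball (e p) (ρ / 4), ?_, ?_⟩
  · exact (e.isOpen_inter_preimage Metric.isOpen_ball).mem_nhds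
      ⟨hp, Metric.mem_ball_self (by positivity)⟩
  filter_upwards [Metric.ball_mem_nhds ζ₀ (lt_min hδ₀ (show 0 < ρ / (4 * (L + 1)) by positivity))]
    with ζ hζ i hi
  obtain ⟨hζ1, hζ2⟩ := lt_min_iff.1 (Metric.mem_ball.1 hζ)
  set γ : ℝ → ℂ := fun t => ζ₀ + (t : ℂ) * (ζ - ζ₀) with hγ
  have hγc : Continuous γ := by fun_prop
  have hγn : ∀ t ∈ Set.Icc (0 : ℝ) 1, ‖γ t - ζ₀‖ ≤ ‖ζ - ζ₀‖ := by
    intro t ht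
    simp only [hγ, add_sub_cancel_left, norm_mul, Complex.norm_real, Real.norm_eq_abs,
      abs_of_nonneg ht.1]
    exact mul_le_of_le_one_left (norm_nonneg _) ht.2
  set U : Set M := e.source ∩ e ⁻¹' Metric.ball (e p) ρ
  have hU : IsOpen U := e.isOpen_inter_preimage Metric.isOpen_ball
  have hFc : Continuous (F i) := (hF i).continuous
  have hUW : U ⊆ W := fun x hx => by
    have := (hball (Metric.ball_subset_closedBall hx.2)).2
    rwa [Set.mem_preimage, e.left_inv hx.1] at this
  set P : Set M := e.symm '' Metric.closedBall (e p) (ρ / 2)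
  have hP : IsClosed P := ((isCompact_closedBall _ _).image_of_continuousOn
    (e.continuousOn_symm.mono
      ((Metric.closedBall_subset_closedBall (by linarith)).trans hsub))).isClosed
  have hPU : P ⊆ U := by
    rintro _ ⟨y, hy, rfl⟩
    have hyt := hsub (Metric.closedBall_subset_closedBall (by linarith) hy)
    refine ⟨e.map_target hyt, ?_⟩
    rw [Set.mem_preimage, e.right_inv hyt]
    exact Metric.closedBall_subset_ball (by linarith) hy
  -- Bootstrap: a path that stays in `U` up to time `t` starts within `ρ / 4` of the centre and
  -- moves at most `ρ / 4`, so it lies in the smaller closed set `P`.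
  have hstep : ∀ t ∈ Set.Icc (0 : ℝ) 1, (∀ s ∈ Set.Icc 0 t, F i (γ s) ∈ U) → F i (γ t) ∈ P := by
    intro t ht hs
    have hmem : ∀ w ∈ segment ℝ ζ₀ (γ t), w ∈ Metric.ball ζ₀ δ₀ ∧ F i w ∈ U := by
      intro w hw
      rw [segment_eq_image'] at hw
      obtain ⟨θ, hθ, rfl⟩ := hw
      have hγθ : ζ₀ + θ • (γ t - ζ₀) = γ (θ * t) := by
        simp only [hγ, add_sub_cancel_left, Complex.real_smul, Complex.ofReal_mul, mul_assoc]
      have hθt : θ * t ∈ Set.Icc 0 t :=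
        ⟨mul_nonneg hθ.1 ht.1, mul_le_of_le_one_left ht.1 hθ.2⟩
      simp only [hγθ]
      refine ⟨?_, hs _ hθt⟩
      rw [Metric.mem_ball, dist_eq_norm]
      exact (hγn _ ⟨hθt.1, hθt.2.trans ht.2⟩).trans_lt (by rwa [dist_eq_norm] at hζ1)
    have hbd : ∀ w ∈ segment ℝ ζ₀ (γ t), ‖deriv (e ∘ F i) w‖ ≤ L := by
      intro w hw
      obtain ⟨hw1, hw2⟩ := hmem w hw
      have h1 := hK i w hw1
      rw [h.speed_eq_chartLength he (hF i) hw2.1] at h1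
      have h2 := (hcb _ (Metric.ball_subset_closedBall hw2.2) (deriv (e ∘ F i) w)).1
      rw [le_div_iff₀ hc, mul_comm]
      exact h2.trans (h1.trans (le_abs_self K))
    have hmv := Convex.norm_image_sub_le_of_norm_deriv_le
      (fun w hw => differentiableAt_chart_comp he (hF i) (hmem w hw).2.1) hbd
      (convex_segment _ _) (left_mem_segment ℝ _ _) (right_mem_segment ℝ _ _)
    have hlt : L * ‖γ t - ζ₀‖ ≤ ρ / 4 := by
      have h3 : ‖γ t - ζ₀‖ ≤ ρ / (4 * (L + 1)) :=
        (hγn t ht).trans (by rw [dist_eq_norm] at hζ2; exact hζ2.le)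
      calc L * ‖γ t - ζ₀‖ ≤ (L + 1) * (ρ / (4 * (L + 1))) := by gcongr; linarith
        _ = ρ / 4 := by field_simp
    have hUt := hs t ⟨ht.1, le_rfl⟩
    refine ⟨e (F i (γ t)), ?_, e.left_inv hUt.1⟩
    have h4 : dist (e (F i ζ₀)) (e p) < ρ / 4 := hi.2
    have h5 : dist (e (F i (γ t))) (e (F i ζ₀)) ≤ ρ / 4 := by
      rw [dist_eq_norm]; exact hmv.trans hlt
    rw [Metric.mem_closedBall]
    linarith [dist_triangle (e (F i (γ t))) (e (F i ζ₀)) (e p)]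
  have hγ0 : γ 0 = ζ₀ := by simp [hγ]
  have hγ1 : γ 1 = ζ := by simp [hγ]
  have hU0 : F i (γ 0) ∈ U := by
    rw [hγ0]
    exact ⟨hi.1, Metric.ball_subset_ball (by linarith) hi.2⟩
  suffices hall : ∀ t ∈ Set.Icc (0 : ℝ) 1, F i (γ t) ∈ U by
    have := hall 1 ⟨zero_le_one, le_rfl⟩
    rw [hγ1] at this
    exact hUW this
  by_contra! hne
  -- At the first exit time from `U`, all earlier points lie in the closed set `P ⊆ U`, hence so
  -- does the exit point.
  have hS : IsCompact (Set.Icc (0 : ℝ) 1 ∩ (F i ∘ γ) ⁻¹' Uᶜ) :=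
    isCompact_Icc.inter_right (hU.isClosed_compl.preimage (hFc.comp hγc))
  obtain ⟨t, ⟨ht, htU⟩, hmin⟩ := hS.exists_isLeast hne
  have ht0 : 0 < t := lt_of_le_of_ne ht.1 (by rintro rfl; exact htU hU0)
  have hbefore : ∀ s ∈ Set.Ico 0 t, F i (γ s) ∈ U := by
    intro s hs
    by_contra hsU
    exact absurd (hmin ⟨⟨hs.1, hs.2.le.trans ht.2⟩, hsU⟩) (not_le.2 hs.2)
  have hPs : ∀ s ∈ Set.Ico 0 t, F i (γ s) ∈ P := fun s hs =>
    hstep s ⟨hs.1, hs.2.le.trans ht.2⟩ fun r hr => hbefore r ⟨hr.1, hr.2.trans_lt hs.2⟩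
  have htc : t ∈ closure (Set.Ico 0 t) := by
    rw [closure_Ico ht0.ne]; exact ⟨ht0.le, le_rfl⟩
  exact htU (hPU ((hP.preimage (hFc.comp hγc)).closure_subset_iff.2 hPs htc))

/-- A family of holomorphic curves in a compact manifold is equicontinuous where its speed is
bounded. -/
theorem equicontinuousAt_of_speed_le {k : ℕ} {M : Type*} [UniformSpace M] [CompactSpace M]
    [T2Space M] [ChartedSpace (Cn k) M] [IsManifold 𝓘(ℂ, Cn k) ω M] (h : HermitianMetric k M)
    {ι : Type*} {F : ι → ℂ → M} (hF : ∀ i, MDifferentiable 𝓘(ℂ, ℂ) 𝓘(ℂ, Cn k) (F i))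
    {ζ₀ : ℂ} {δ₀ K : ℝ} (hδ₀ : 0 < δ₀)
    (hK : ∀ i, ∀ ζ ∈ Metric.ball ζ₀ δ₀, h.speed (F i) ζ ≤ K) : EquicontinuousAt F ζ₀ := by
  intro U hU
  obtain ⟨W, hW, hWs, hWU⟩ := comp_symm_of_uniformity hU
  choose V hV hVW using fun p : M => h.exists_nhds_eventually_mem_of_speed_le hF hδ₀ hK
    (UniformSpace.ball_mem_nhds p hW)
  -- Finitely many `V p` cover `M`, so one neighbourhood of `ζ₀` serves all curves, wherever they
  -- start.
  obtain ⟨t, -, ht⟩ := isCompact_univ.elim_nhds_subcover (fun p => V p ∩ UniformSpace.ball p W)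
    fun p _ => inter_mem (hV p) (UniformSpace.ball_mem_nhds p hW)
  filter_upwards [(eventually_all_finset t).2 fun p _ => hVW p] with ζ hζ i
  obtain ⟨p, hp, hpV, hpW⟩ := Set.mem_iUnion₂.1 (ht (Set.mem_univ (F i ζ₀)))
  exact hWU ⟨p, hWs hpW, hζ p hp i hpV⟩

/-- The speed at the origin is locally bounded on the space of holomorphic curves. -/
theorem exists_eventually_speed_le (h : HermitianMetric k M) (G : HolMap ℂ (Cn k) ℂ M) :
    ∃ B : ℝ, ∀ᶠ F in 𝓝 G, h.speed F.1 0 ≤ B := by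
  set e := chartAt (Cn k) (G.1 0)
  have he : e ∈ atlas (Cn k) M := chart_mem_atlas _ _
  have hp : G.1 0 ∈ e.source := mem_chart_source _ _
  obtain ⟨ρ, hρ, hsub⟩ := Metric.nhds_basis_closedBall.mem_iff.1
    (e.open_target.mem_nhds (e.map_source hp))
  obtain ⟨_, C, -, hC, hCb⟩ :=
    h.exists_chartLength_bounds he (isCompact_closedBall (e (G.1 0)) ρ) hsub
  set V : Set M := e.source ∩ e ⁻¹' Metric.ball (e (G.1 0)) ρ
  have hV : IsOpen V := e.isOpen_inter_preimage Metric.isOpen_ball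
  have hGV : G.1 0 ∈ V := ⟨hp, Metric.mem_ball_self hρ⟩
  obtain ⟨r, hr, hrV⟩ := Metric.nhds_basis_closedBall.mem_iff.1
    (G.1.continuous.continuousAt.preimage_mem_nhds (hV.mem_nhds hGV))
  -- Mapping a compact disc into an open set is an open condition; Cauchy's estimate on that disc
  -- then applies to all nearby `F`.
  have hev : ∀ᶠ F in 𝓝 G, Set.MapsTo F.1 (Metric.closedBall 0 r) V :=
    continuous_subtype_val.continuousAt.eventually
      (ContinuousMap.eventually_mapsTo (isCompact_closedBall 0 r) hV hrV)
  refine ⟨C * ((‖e (G.1 0)‖ + ρ) / r), hev.mono fun F hFV => ?_⟩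
  have h0 := hFV (Metric.mem_closedBall_self hr.le)
  have hdiff : ∀ w ∈ Metric.closedBall (0 : ℂ) r, DifferentiableAt ℂ (e ∘ F.1) w :=
    fun w hw => differentiableAt_chart_comp he F.2 (hFV hw).1
  have hd : ‖deriv (e ∘ F.1) 0‖ ≤ (‖e (G.1 0)‖ + ρ) / r := by
    refine Complex.norm_deriv_le_of_forall_mem_sphere_norm_le hr ?_ fun w hw => ?_
    · refine DifferentiableOn.diffContOnCl fun w hw => (hdiff w ?_).differentiableWithinAt
      exact Metric.closure_ball_subset_closedBall hw
    · exact norm_le_of_mem_closedBall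
        (Metric.ball_subset_closedBall (hFV (Metric.sphere_subset_closedBall hw)).2)
  rw [h.speed_eq_chartLength he F.2 h0.1]
  exact (hCb _ (Metric.ball_subset_closedBall h0.2) _).2.trans (by gcongr)

theorem exists_speed_le_of_isCompact (h : HermitianMetric k M) {S : Set (HolMap ℂ (Cn k) ℂ M)}
    (hS : IsCompact S) : ∃ B : ℝ, ∀ F ∈ S, h.speed F.1 0 ≤ B := by
  choose B hB using h.exists_eventually_speed_le
  refine hS.induction_on (p := fun S => ∃ B : ℝ, ∀ F ∈ S, h.speed F.1 0 ≤ B) ⟨0, by simp⟩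
    (fun s t hst ⟨b, hb⟩ => ⟨b, fun F hF => hb F (hst hF)⟩) ?_
    fun G _ => ⟨_, mem_nhdsWithin_of_mem_nhds (hB G), B G, fun F hF => hF⟩
  rintro s t ⟨b, hb⟩ ⟨c, hc⟩
  exact ⟨max b c, fun F hF => hF.elim (fun h1 => (hb F h1).trans (le_max_left _ _))
    fun h1 => (hc F h1).trans (le_max_right _ _)⟩

end HermitianMetric

/-! ### Closedness and compactness in the space of holomorphic curves. -/

/-- **Weierstrass' theorem** for curves in complex manifolds: holomorphic curves form a closed
subspace of the continuous ones. -/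
theorem isClosed_setOf_mdifferentiable {k : ℕ} {M : Type*} [TopologicalSpace M] [CompactSpace M]
    [T2Space M] [ChartedSpace (Cn k) M] [IsManifold 𝓘(ℂ, Cn k) ω M] :
    IsClosed {F : C(ℂ, M) | MDifferentiable 𝓘(ℂ, ℂ) 𝓘(ℂ, Cn k) F} := by
  let _ : UniformSpace M := uniformSpaceOfCompactR1
  have : IsManifold 𝓘(ℂ, Cn k) 1 M := IsManifold.of_le (n := ω) le_top
  refine isClosed_of_closure_subset fun G hG ζ₀ => ?_
  set e := chartAt (Cn k) (G ζ₀)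
  have he : e ∈ atlas (Cn k) M := chart_mem_atlas _ _
  have hp : G ζ₀ ∈ e.source := mem_chart_source _ _
  obtain ⟨Q, hQ, hQe, hQc⟩ := local_compact_nhds (e.open_source.mem_nhds hp)
  obtain ⟨r, hr, hrQ⟩ := Metric.nhds_basis_closedBall.mem_iff.1
    (G.continuous.continuousAt.preimage_mem_nhds (interior_mem_nhds.2 hQ))
  set l := 𝓝[{F : C(ℂ, M) | MDifferentiable 𝓘(ℂ, ℂ) 𝓘(ℂ, Cn k) F}] G
  have : l.NeBot := mem_closure_iff_nhdsWithin_neBot.1 hG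
  have hev : ∀ᶠ F : C(ℂ, M) in l, Set.MapsTo F (Metric.closedBall ζ₀ r) Q :=
    ((ContinuousMap.eventually_mapsTo (isCompact_closedBall ζ₀ r) isOpen_interior hrQ).filter_mono
      nhdsWithin_le_nhds).mono fun F hF w hw => interior_subset (hF hw)
  have hunif : TendstoUniformlyOn (fun (F : C(ℂ, M)) w => F w) G l (Metric.closedBall ζ₀ r) :=
    ContinuousMap.tendsto_iff_forall_isCompact_tendstoUniformlyOn.1
      (tendsto_id'.2 nhdsWithin_le_nhds) _ (isCompact_closedBall ζ₀ r)
  -- The chart is uniformly continuous on the compact set `Q`, so uniform convergence passes to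
  -- coordinates, where the classical Weierstrass theorem applies.
  have hunif' : TendstoUniformlyOn (fun (F : C(ℂ, M)) w => e (F w)) (fun w => e (G w)) l
      (Metric.closedBall ζ₀ r) :=
    UniformContinuousOn.comp_tendstoUniformlyOn_eventually hev
      (fun w hw => interior_subset (hrQ hw))
      (hQc.uniformContinuousOn_of_continuous (e.continuousOn.mono hQe)) hunif
  have hdiff : DifferentiableOn ℂ (fun w => e (G w)) (Metric.ball ζ₀ r) := by
    refine (hunif'.mono Metric.ball_subset_closedBall).tendstoLocallyUniformlyOn.differentiableOn
      ?_ Metric.isOpen_ball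
    filter_upwards [hev, self_mem_nhdsWithin] with F hF hFd w hw
    exact (HermitianMetric.differentiableAt_chart_comp he hFd
      (hQe (hF (Metric.ball_subset_closedBall hw)))).differentiableWithinAt
  have hat : DifferentiableAt ℂ (fun w => e (G w)) ζ₀ :=
    hdiff.differentiableAt (Metric.ball_mem_nhds ζ₀ hr)
  have hcomp : MDifferentiableAt 𝓘(ℂ, ℂ) 𝓘(ℂ, Cn k) (e.symm ∘ fun w => e (G w)) ζ₀ :=
    (mdifferentiableAt_atlas_symm he (e.map_source hp)).comp ζ₀ hat.mdifferentiableAt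
  refine hcomp.congr_of_eventuallyEq ?_
  filter_upwards [G.continuous.continuousAt.preimage_mem_nhds (e.open_source.mem_nhds hp)]
    with w hw
  exact (e.left_inv hw).symm

/-- **Montel's theorem** for curves in compact complex manifolds. -/
theorem isCompact_closure_of_equicontinuous {k : ℕ} {M : Type*} [UniformSpace M] [CompactSpace M]
    [T2Space M] [ChartedSpace (Cn k) M] [IsManifold 𝓘(ℂ, Cn k) ω M]
    {S : Set (HolMap ℂ (Cn k) ℂ M)} (hS : Equicontinuous fun F : S => (F.1.1 : ℂ → M)) :
    IsCompact (closure S) := by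
  -- Continuous maps are closed under uniform convergence on compact sets because the topology of
  -- `ℂ` is determined by its compact subsets.
  have hemb : IsClosedEmbedding
      (ContinuousMap.toUniformOnFunIsCompact : C(ℂ, M) → UniformOnFun ℂ M {K | IsCompact K}) := by
    refine ⟨ContinuousMap.isUniformEmbedding_toUniformOnFunIsCompact.isEmbedding, ?_⟩
    rw [ContinuousMap.range_toUniformOnFunIsCompact]
    exact UniformOnFun.isClosed_setOfPred_continuous
      (CompactlyCoherentSpace.isCoherentWith)
  have hemb' := hemb.comp
    (isClosed_setOf_mdifferentiable (k := k) (M := M)).isClosedEmbedding_subtypeVal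
  exact ArzelaAscoli.isCompact_closure_of_isClosedEmbedding
    (F := fun F : HolMap ℂ (Cn k) ℂ M => (F.1 : ℂ → M)) (𝔖 := {K | IsCompact K})
    (fun K hK => hK) hemb' (fun K _ => hS.equicontinuousOn K)
    (fun K _ x _ => ⟨Set.univ, isCompact_univ, fun _ _ => Set.mem_univ _⟩)

/-! ### Rescaled curves and the equivalence. -/

theorem HermitianMetric.speed_rescale {m k : ℕ} {M : Type*} [TopologicalSpace M]
    [ChartedSpace (Cn k) M] (h : HermitianMetric k M) (f : HolMap (Cn m) (Cn k) (Cn m) M)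
    (z : Cn m) (t : ℝ) (ξ : Cn m) (ζ : ℂ) :
    h.speed (rescale f z t ξ).1 ζ = |t| * h.length (f.1 (z + ((t : ℂ) * ζ) • ξ))
      (mfderiv 𝓘(ℂ, Cn m) 𝓘(ℂ, Cn k) f.1 (z + ((t : ℂ) * ζ) • ξ) ξ) := by
  set g : ℂ → Cn m := fun ζ => z + ((t : ℂ) * ζ) • ξ
  have hg : HasDerivAt g ((t : ℂ) • ξ) ζ := by
    have h1 : HasDerivAt (fun ζ : ℂ => (t : ℂ) * ζ) (t : ℂ) ζ := by
      simpa using (hasDerivAt_id ζ).const_mul (t : ℂ)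
    exact (h1.smul_const ξ).const_add z
  have hc : mfderiv 𝓘(ℂ, ℂ) 𝓘(ℂ, Cn k) (f.1 ∘ g) ζ =
      (mfderiv 𝓘(ℂ, Cn m) 𝓘(ℂ, Cn k) f.1 (g ζ)).comp (mfderiv 𝓘(ℂ, ℂ) 𝓘(ℂ, Cn m) g ζ) :=
    mfderiv_comp ζ (f.2 _) hg.differentiableAt.mdifferentiableAt
  have hv : mfderiv 𝓘(ℂ, ℂ) 𝓘(ℂ, Cn k) (f.1 ∘ g) ζ (1 : ℂ) =
      (t : ℂ) • mfderiv 𝓘(ℂ, Cn m) 𝓘(ℂ, Cn k) f.1 (g ζ) ξ := by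
    rw [hc, mfderiv_eq_fderiv]
    change mfderiv 𝓘(ℂ, Cn m) 𝓘(ℂ, Cn k) f.1 (g ζ) (fderiv ℂ g ζ 1) = _
    rw [fderiv_apply_one_eq_deriv, hg.deriv]
    exact (mfderiv 𝓘(ℂ, Cn m) 𝓘(ℂ, Cn k) f.1 (g ζ)).map_smul _ _
  have hl := h.length_smul (f.1 (g ζ)) (t : ℂ) (mfderiv 𝓘(ℂ, Cn m) 𝓘(ℂ, Cn k) f.1 (g ζ) ξ)
  rw [Complex.norm_real, Real.norm_eq_abs] at hl
  rw [← hl]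
  exact h.length_congr rfl hv

theorem isWeightedYosida_iff {m k : ℕ} {M : Type*} [TopologicalSpace M] [ChartedSpace (Cn k) M]
    (h : HermitianMetric k M) (φ : ℝ → ℝ) (f : HolMap (Cn m) (Cn k) (Cn m) M) :
    IsWeightedYosida h φ f ↔ ∃ B R : ℝ, ∀ z ξ : Cn m, R ≤ ‖z‖ → ‖ξ‖ = 1 →
      φ ‖z‖ * h.length (f.1 z) (mfderiv 𝓘(ℂ, Cn m) 𝓘(ℂ, Cn k) f.1 z ξ) ≤ B := by
  have hbasis : (comap (fun z : Cn m ↦ ‖z‖) atTop ×ˢ 𝓟 {ξ : Cn m | ‖ξ‖ = 1}).HasBasis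
      (fun _ : ℝ => True) fun R => {z : Cn m | R ≤ ‖z‖} ×ˢ {ξ : Cn m | ‖ξ‖ = 1} :=
    ((atTop_basis (α := ℝ)).comap _).prod_principal _
  constructor
  · intro hlim
    obtain ⟨b, hb1, hb2⟩ := exists_between hlim
    obtain ⟨R, -, hR⟩ := hbasis.eventually_iff.1 (eventually_lt_of_limsup_lt hb1)
    refine ⟨b.toReal, R, fun z ξ hz hξ => ?_⟩
    exact (ENNReal.ofReal_le_iff_le_toReal hb2.ne).1 (hR (x := (z, ξ)) ⟨hz, hξ⟩).le
  · rintro ⟨B, R, hB⟩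
    refine lt_of_le_of_lt (limsup_le_of_le (a := ENNReal.ofReal B) (by isBoundedDefault) ?_)
      ENNReal.ofReal_lt_top
    exact hbasis.eventually_iff.2
      ⟨R, trivial, fun q hq => ENNReal.ofReal_le_ofReal (hB q.1 q.2 hq.1 hq.2)⟩

/-- The speed bounds hold only for large `j`, depending on the point; the finitely many remaining
curves are continuous. -/
theorem equicontinuousAt_of_tail {X α : Type*} [TopologicalSpace X] [UniformSpace α]
    {F : ℕ → X → α} (hF : ∀ j, Continuous (F j)) (x : X)
    (h : ∃ N, EquicontinuousAt (fun j : {j : ℕ // N ≤ j} => F j) x) : EquicontinuousAt F x := by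
  obtain ⟨N, hN⟩ := h
  intro U hU
  have h1 : ∀ᶠ y in 𝓝 x, ∀ j ∈ Finset.range N, (F j x, F j y) ∈ U :=
    (eventually_all_finset _).2 fun j _ =>
      (hF j).continuousAt.eventually (mem_nhds_left (F j x) hU)
  filter_upwards [h1, hN U hU] with y hy1 hy2 j
  rcases lt_or_ge j N with hj | hj
  · exact hy1 j (Finset.mem_range.2 hj)
  · exact hy2 ⟨j, hj⟩

theorem mainTheorem2 (m k : ℕ) {M : Type*} [TopologicalSpace M] [T2Space M] [CompactSpace M]
    [ChartedSpace (Cn k) M] [IsManifold 𝓘(ℂ, Cn k) ω M] (h : HermitianMetric k M)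
    (φ : ℝ → ℝ) (hφ : IsYosidaWeight φ) (f : HolMap (Cn m) (Cn k) (Cn m) M) :
    IsWeightedYosida h φ f ↔
      ∀ z ξ : ℕ → Cn m, Tendsto (fun j ↦ ‖z j‖) atTop atTop → (∀ j, ‖ξ j‖ = 1) →
        IsNormalFamily (Set.range fun j ↦ rescale f (z j) (φ ‖z j‖) (ξ j)) := by
  rw [isWeightedYosida_iff]
  constructor
  · rintro ⟨B, R, hB⟩ z ξ hz hξ u hu
    let _ : UniformSpace M := uniformSpaceOfCompactR1
    -- The whole family is relatively compact, so no subsequence need be extracted.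
    refine ⟨id, strictMono_id, ?_⟩
    have hequi : Equicontinuous
        fun j => ((rescale f (z j) (φ ‖z j‖) (ξ j)).1 : ℂ → M) := by
      intro ζ₀
      refine equicontinuousAt_of_tail
        (fun j => (rescale f (z j) (φ ‖z j‖) (ξ j)).1.continuous) ζ₀ ?_
      -- The radius `‖ζ₀‖ + 1` covers the unit disc about `ζ₀`.
      obtain ⟨T, hT⟩ := hφ.exists_le_two_mul (r := ‖ζ₀‖ + 1) (by positivity) R
      obtain ⟨N, hN⟩ := eventually_atTop.1 (hz.eventually_ge_atTop T)
      refine ⟨N, h.equicontinuousAt_of_speed_le (K := 2 * B)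
        (fun j : {j : ℕ // N ≤ j} => (rescale f (z j) (φ ‖z j‖) (ξ j)).2) one_pos ?_⟩
      rintro ⟨j, hj⟩ ζ hζ
      have hφj := hφ.pos ‖z j‖ (norm_nonneg _)
      have hζn : ‖ζ‖ ≤ ‖ζ₀‖ + 1 := by
        have h1 := norm_sub_norm_le ζ ζ₀
        rw [Metric.mem_ball, dist_eq_norm] at hζ
        linarith
      rw [h.speed_rescale]
      set w := z j + ((φ ‖z j‖ : ℂ) * ζ) • ξ j with hw
      have hdist : |‖w‖ - ‖z j‖| ≤ (‖ζ₀‖ + 1) * φ ‖z j‖ := by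
        refine (abs_norm_sub_norm_le _ _).trans ?_
        rw [hw, add_sub_cancel_left, norm_smul, hξ, mul_one, norm_mul, Complex.norm_real,
          Real.norm_eq_abs, abs_of_pos hφj, mul_comm]
        gcongr
      obtain ⟨hRw, hφw, hle⟩ := hT _ _ (hN j hj) hdist
      have hlen : 0 ≤ h.length (f.1 w) (mfderiv 𝓘(ℂ, Cn m) 𝓘(ℂ, Cn k) f.1 w (ξ j)) :=
        Real.sqrt_nonneg _
      rw [abs_of_pos hφj]
      have := hB w (ξ j) hRw (hξ j)
      nlinarith [mul_le_mul_of_nonneg_right hle hlen]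
    refine (isCompact_closure_of_equicontinuous
      (S := Set.range fun j ↦ rescale f (z j) (φ ‖z j‖) (ξ j)) ?_).of_isClosed_subset
        isClosed_closure (closure_mono (Set.range_subset_iff.2 hu))
    intro ζ U hU
    filter_upwards [hequi ζ U hU] with w hw
    rintro ⟨_, j, rfl⟩
    exact hw j
  · intro hnormal
    by_contra! hne
    -- Failure with both bounds equal to `n` gives `‖z n‖ ≥ n` and a Yosida quantity greater than
    -- `n`.
    choose z ξ hz hξ hlarge using fun n : ℕ => hne n n
    obtain ⟨s, hs, hcomp⟩ := hnormal z ξ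
      (tendsto_atTop_mono hz tendsto_natCast_atTop_atTop) hξ _ fun j => ⟨j, rfl⟩
    obtain ⟨B, hB⟩ := h.exists_speed_le_of_isCompact hcomp
    obtain ⟨n, hn⟩ := exists_nat_gt B
    have h1 := hB _ (subset_closure ⟨n, rfl⟩)
    rw [Function.comp_apply, h.speed_rescale, abs_of_pos (hφ.pos _ (norm_nonneg _))] at h1
    have h0 : ∀ t : ℂ, z (s n) + (t * 0) • ξ (s n) = z (s n) := fun t => by simp
    rw [h0] at h1
    have h2 : (n : ℝ) ≤ s n := by exact_mod_cast hs.id_le n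
    linarith [hlarge (s n)]
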